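/- **Setting.** Let $H\subset X$ be real Hilbert spaces, $H$ dense in $X$, with $\|v\|_X\le\kappa\|v\|_H$. Let $X_0\subset X$ be a closed subspace of finite codimension and $\Pi_0$ the $X$-orthogonal projection onto it. Let $\mathcal P\subset\mathbb R^n$ (a set with unique derivatives, e.g. a domain with or without boundary), let $\Phi:\mathcal P\to H$ be $C^1$, $\mathcal M=\Phi(\mathcal P)$, and $\mathcal T_{\mathbf p}=\mathrm{span}\{\partial\Phi/\partial p_i(\mathbf p)\}_{i=1}^n$. Let $J:H\to\mathbb R$ be $C^2$ near each point of $\mathcal M$, and consider $F(u)=-\Pi_0\nabla_XJ(u)$. The second variation $\nabla_X^2J(\Phi(\mathbf p))$ is the symmetric bilinear form $\langle\nabla_X^2J\,v,w\rangle_X=D^2J(\Phi(\mathbf p))[v,w]$ on $H$, and $\mathbb L_{\mathbf p}=-\Pi_0\nabla_X^2J(\Phi(\mathbf p))\Pi_0$ is minus the operator on $X_0$ generated by this form on $H\cap X_0$; its domain consists of those $v\in H\cap X_0$ for which there is $f\in X_0$ with $\langle f,w\rangle_X=-D^2J(\Phi(\mathbf p))[v,w]$ for all $w\in H\cap X_0$,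 and then $\mathbb L_{\mathbf p}v=f$. On $H\cap X_0$, $\langle-\mathbb L_{\mathbf p}v,v\rangle_X$ denotes the value $D^2J(\Phi(\mathbf p))[v,v]$ of the form. **Hypotheses.** Let $k_s,c_0,C_0,C_2,C_3,C_4,\mu_e,\gamma_e,\delta>0$ and suppose that for all $\mathbf p\in\mathcal P$: (H0) $F(\Phi(\mathbf p))\in H$ and $\|F(\Phi(\mathbf p))\|_H\le C_0\delta$. (H1) The spectrum of $\mathbb L_{\mathbf p}$ is contained in $(-\infty,-k_s]\cup[-c_0\delta,c_0\delta]$; the points of the spectrum in $[-c_0\delta,c_0\delta]$ are eigenvalues, whose eigenvectors span a space $Y_{\mathbf p}$ (the slow eigenspace) of dimension $n$; and $\dim\mathcal T_{\mathbf p}=n$. (H2) $\mathbb L_{\mathbf p}$ generates a $C_0$ semigroup $S_{\mathbf p}$ on $X_0$ with $\|S_{\mathbf p}(t)u\|_H\le C_2e^{-k_st}\|u\|_H$ for all $t\ge0$ and all $u\in H\cap X_0$ that are $X$-orthogonal to $Y_{\mathbf p}$. (H3) There are $X$-orthonormal eigenvectors $\psi_1(\mathbf p),\dots,\psi_n(\mathbf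 p)$ of $\mathbb L_{\mathbf p}$ spanning $Y_{\mathbf p}$ with $\|\psi_i(\mathbf p)-\partial\Phi/\partial p_i(\mathbf p)\|_H\le C_3\delta$ for $i=1,\dots,n$. (H4) These are $C^2$ in $\mathbf p$ with values in $H$, and $\|\psi_i(\mathbf p)\|_H+\|\nabla^2_{\mathbf p}\psi_i(\mathbf p)\|_H\le C_4$ for $i=1,\dots,n$. (EH1) $\Phi(\mathbf p)\in u_0+X_0$, where $u_0\in H$ is the initial datum. (EA) $\langle(\nabla_X^2J(\Phi(\mathbf p))+\gamma_e)v,v\rangle_X\ge\mu_e\|v\|_H^2$ for all $v\in H\cap X_0$. **Conclusion.** If $\delta$ is sufficiently small, then $\mathcal M$ is uniformly normally $H$-coercive. Precisely, there are $\delta_0>0$ and $\mu>0$, depending only on $n,\kappa,k_s,c_0,C_0,C_2,C_3,C_4,\mu_e,\gamma_e$, such that whenever $\delta\le\delta_0$ and the hypotheses hold, $$\langle-\mathbb L_{\mathbf p}v,v\rangle_X\ge\mu\|v\|_H^2\qquad\text{for all }\mathbf p\in\mathcal P\text{ and all }v\in H\cap X_0\text{ with }v\perp_X\mathcal T_{\mathbf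 p}.$$ -/

import Mathlib

open Filter Topology Set
open scoped NNReal

/-! Unbounded operators on a real Hilbert space and strongly continuous semigroups. -/

section Operators

/-- The resolvent set of an unbounded operator `A`: `A - lam` maps the domain of `A` onto the
whole space and has a bounded inverse. -/
def pmapResolventSet {E : Type*} [NormedAddCommGroup E] [InnerProductSpace ℝ E]
    (A : E →ₗ.[ℝ] E) : Set ℝ :=
  {lam | (∀ f : E, ∃ x : A.domain, A x - lam • (x : E) = f) ∧
    ∃ C : ℝ, ∀ x : A.domain, ‖(x : E)‖ ≤ C * ‖A x - lam • (x : E)‖}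

/-- The spectrum of an unbounded operator. It is used only for operators that are self-adjoint,
so that the whole spectrum is real. -/
def pmapSpectrum {E : Type*} [NormedAddCommGroup E] [InnerProductSpace ℝ E]
    (A : E →ₗ.[ℝ] E) : Set ℝ :=
  (pmapResolventSet A)ᶜ

/-- The span of all eigenvectors of `A` with an eigenvalue of absolute value at most `a`. -/
def slowEigenspace {E : Type*} [NormedAddCommGroup E] [InnerProductSpace ℝ E]
    (A : E →ₗ.[ℝ] E) (a : ℝ) : Submodule ℝ E :=
  Submodule.span ℝ {x | ∃ lam : ℝ, |lam| ≤ a ∧ (x, lam • x) ∈ A.graph}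

/-- `S` is a strongly continuous (`C₀`) semigroup of bounded operators. -/
structure IsC0Semigroup {E : Type*} [NormedAddCommGroup E] [InnerProductSpace ℝ E]
    (S : ℝ≥0 → E →L[ℝ] E) : Prop where
  zero : S 0 = ContinuousLinearMap.id ℝ E
  add : ∀ s t : ℝ≥0, S (s + t) = (S s).comp (S t)
  tendsto_zero : ∀ x : E, Tendsto (fun t : ℝ≥0 => S t x) (𝓝 0) (𝓝 x)

/-- `A` is the infinitesimal generator of `S`: `x` lies in the domain of `A` and `A x = y` exactly
when the difference quotients `(S t x - x) / t` converge to `y` as `t → 0+`. -/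
def IsGeneratorOf {E : Type*} [NormedAddCommGroup E] [InnerProductSpace ℝ E]
    (A : E →ₗ.[ℝ] E) (S : ℝ≥0 → E →L[ℝ] E) : Prop :=
  ∀ x y : E, (x, y) ∈ A.graph ↔
    Tendsto (fun t : ℝ≥0 => (t : ℝ)⁻¹ • (S t x - x)) (𝓝[>] 0) (𝓝 y)

end Operators

/-! The gradient flow `u_t = F(u) = -Π₀ ∇_X J(u)` for an energy `J` on `H`, where the inclusion of
`H` into `X` is written `ι` and `Π₀` is the `X`-orthogonal projection onto the closed subspace
`X₀`. -/

section GradientFlow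

/-- `F(u) = f`, where `F = -Π₀ ∇_X J`: the element `f` of `X₀` satisfies
`⟨f, w⟩_X = - dJ(u) w` for all `w ∈ H ∩ X₀`. -/
def IsVectorField {H X : Type*} [NormedAddCommGroup H] [InnerProductSpace ℝ H]
    [NormedAddCommGroup X] [InnerProductSpace ℝ X]
    (ι : H →L[ℝ] X) (X₀ : Submodule ℝ X) (J : H → ℝ) (u : H) (f : X₀) : Prop :=
  ∀ w : H, ι w ∈ X₀ → inner ℝ (f : X) (ι w) = -(fderiv ℝ J u w)

/-- The second variation of `J` at `u`, as a bilinear form: `⟨∇_X² J(u) v, w⟩_X`. -/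
noncomputable def secondVariation {H : Type*} [NormedAddCommGroup H] [InnerProductSpace ℝ H]
    (J : H → ℝ) (u v w : H) : ℝ :=
  fderiv ℝ (fderiv ℝ J) u v w

/-- The graph of the linearization `𝕃 = -Π₀ ∇_X² J(u) Π₀` of `F` at `u`: the pairs `(v, f)` with
`v ∈ H ∩ X₀`, `f ∈ X₀` and `⟨f, w⟩_X = -⟨∇_X² J(u) v, w⟩_X` for all `w ∈ H ∩ X₀`. -/
def linearizationGraph {H X : Type*} [NormedAddCommGroup H] [InnerProductSpace ℝ H]
    [NormedAddCommGroup X] [InnerProductSpace ℝ X]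
    (ι : H →L[ℝ] X) (X₀ : Submodule ℝ X) (J : H → ℝ) (u : H) : Submodule ℝ (X₀ × X₀) where
  carrier := {q | ∃ v : H, ι v = (q.1 : X) ∧
    ∀ w : H, ι w ∈ X₀ → inner ℝ (q.2 : X) (ι w) = -(secondVariation J u v w)}
  zero_mem' := ⟨0, by simp [secondVariation]⟩
  add_mem' := by
    rintro a b ⟨v, hv, hv'⟩ ⟨w, hw, hw'⟩
    refine ⟨v + w, by simp [hv, hw], fun z hz => ?_⟩
    have h1 := hv' z hz
    have h2 := hw' z hz
    simp only [secondVariation] at h1 h2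
    simp [secondVariation, inner_add_left, h1, h2]
    ring
  smul_mem' := by
    rintro c a ⟨v, hv, hv'⟩
    refine ⟨c • v, by simp [hv], fun z hz => ?_⟩
    have h1 := hv' z hz
    simp only [secondVariation] at h1
    simp [secondVariation, real_inner_smul_left, h1]

/-- The linearization `𝕃 = -Π₀ ∇_X² J(u) Π₀` of `F` at `u`, as an unbounded operator on `X₀` whose
domain is contained in `H ∩ X₀`: minus the operator generated by the second variation of `J` on
`H ∩ X₀`. -/
noncomputable def linearization {H X : Type*} [NormedAddCommGroup H] [InnerProductSpace ℝ H]
    [NormedAddCommGroup X] [InnerProductSpace ℝ X]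
    (ι : H →L[ℝ] X) (X₀ : Submodule ℝ X) (J : H → ℝ) (u : H) : X₀ →ₗ.[ℝ] X₀ :=
  (linearizationGraph ι X₀ J u).toLinearPMap

/-- The tangent vector `∂Φ/∂p_i`. -/
noncomputable def tangentVector {H : Type*} [NormedAddCommGroup H] [InnerProductSpace ℝ H] {n : ℕ}
    (P : Set (EuclideanSpace ℝ (Fin n))) (Φ : EuclideanSpace ℝ (Fin n) → H)
    (p : EuclideanSpace ℝ (Fin n)) (i : Fin n) : H :=
  fderivWithin ℝ Φ P p (EuclideanSpace.single i 1)

/-- The tangent plane of the manifold `Φ(P)` at `Φ(p)`. -/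
noncomputable def tangentPlane {H : Type*} [NormedAddCommGroup H] [InnerProductSpace ℝ H] {n : ℕ}
    (P : Set (EuclideanSpace ℝ (Fin n))) (Φ : EuclideanSpace ℝ (Fin n) → H)
    (p : EuclideanSpace ℝ (Fin n)) : Submodule ℝ H :=
  Submodule.span ℝ (range (tangentVector P Φ p))

end GradientFlow

/-! The hypotheses on the manifold `Φ(P)`. In each of them `δ` is the small parameter. -/

section Hypotheses

/-- (H0) The manifold is quasi-steady: the residual `R(p) = F(Φ(p))` lies in `H` and has `H`-norm
at most `C₀ δ`. -/
def HypH0 {H X : Type*} [NormedAddCommGroup H] [InnerProductSpace ℝ H]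
    [NormedAddCommGroup X] [InnerProductSpace ℝ X] {n : ℕ}
    (ι : H →L[ℝ] X) (X₀ : Submodule ℝ X) (J : H → ℝ)
    (P : Set (EuclideanSpace ℝ (Fin n))) (Φ : EuclideanSpace ℝ (Fin n) → H)
    (C₀ δ : ℝ) : Prop :=
  ∀ p ∈ P, ∃ r : H, ∃ hr : ι r ∈ X₀,
    IsVectorField ι X₀ J (Φ p) ⟨ι r, hr⟩ ∧ ‖r‖ ≤ C₀ * δ

/-- (H1) The spectrum of `𝕃_p` consists of a stable part in `(-∞, -k_s]` and of a slow part in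
`[-c₀ δ, c₀ δ]`; the slow part consists of eigenvalues, the slow eigenspace has dimension `n`, and
so has the tangent plane. -/
def HypH1 {H X : Type*} [NormedAddCommGroup H] [InnerProductSpace ℝ H]
    [NormedAddCommGroup X] [InnerProductSpace ℝ X] {n : ℕ}
    (ι : H →L[ℝ] X) (X₀ : Submodule ℝ X) (J : H → ℝ)
    (P : Set (EuclideanSpace ℝ (Fin n))) (Φ : EuclideanSpace ℝ (Fin n) → H)
    (ks c₀ δ : ℝ) : Prop :=
  ∀ p ∈ P,
    (∀ lam ∈ pmapSpectrum (linearization ι X₀ J (Φ p)), lam ≤ -ks ∨ |lam| ≤ c₀ * δ) ∧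
    (∀ lam ∈ pmapSpectrum (linearization ι X₀ J (Φ p)), |lam| ≤ c₀ * δ →
      ∃ x : X₀, x ≠ 0 ∧ (x, lam • x) ∈ (linearization ι X₀ J (Φ p)).graph) ∧
    FiniteDimensional ℝ (slowEigenspace (linearization ι X₀ J (Φ p)) (c₀ * δ)) ∧
    Module.finrank ℝ (slowEigenspace (linearization ι X₀ J (Φ p)) (c₀ * δ)) = n ∧
    LinearIndependent ℝ (tangentVector P Φ p)

/-- (H2) `𝕃_p` generates a `C₀` semigroup `S_p` on `X₀`, and `‖S_p(t) u‖_H ≤ C₂ e^{-k_s t} ‖u‖_H`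
for all `t ≥ 0` and all `u ∈ H` that are `X`-orthogonal to the slow eigenspace. -/
def HypH2 {H X : Type*} [NormedAddCommGroup H] [InnerProductSpace ℝ H]
    [NormedAddCommGroup X] [InnerProductSpace ℝ X] {n : ℕ}
    (ι : H →L[ℝ] X) (X₀ : Submodule ℝ X) (J : H → ℝ)
    (P : Set (EuclideanSpace ℝ (Fin n))) (Φ : EuclideanSpace ℝ (Fin n) → H)
    (ks c₀ C₂ δ : ℝ) : Prop :=
  ∀ p ∈ P, ∃ S : ℝ≥0 → X₀ →L[ℝ] X₀,
    IsC0Semigroup S ∧ IsGeneratorOf (linearization ι X₀ J (Φ p)) S ∧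
    ∀ (t : ℝ≥0) (u : H) (hu : ι u ∈ X₀),
      (⟨ι u, hu⟩ : X₀) ∈ (slowEigenspace (linearization ι X₀ J (Φ p)) (c₀ * δ))ᗮ →
      ∃ w : H, ι w = (S t ⟨ι u, hu⟩ : X) ∧ ‖w‖ ≤ C₂ * Real.exp (-ks * t) * ‖u‖

/-- The `ψ_1(p), …, ψ_n(p)` are eigenvectors of `𝕃_p` for slow eigenvalues, normalized in `X` and
mutually `X`-orthogonal. -/
def IsSlowEigenbasis {H X : Type*} [NormedAddCommGroup H] [InnerProductSpace ℝ H]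
    [NormedAddCommGroup X] [InnerProductSpace ℝ X] {n : ℕ}
    (ι : H →L[ℝ] X) (X₀ : Submodule ℝ X) (J : H → ℝ)
    (P : Set (EuclideanSpace ℝ (Fin n))) (Φ : EuclideanSpace ℝ (Fin n) → H)
    (ψ : Fin n → EuclideanSpace ℝ (Fin n) → H) (c₀ δ : ℝ) : Prop :=
  ∀ p ∈ P, Orthonormal ℝ (fun i => ι (ψ i p)) ∧
    ∀ i, ∃ (h : ι (ψ i p) ∈ X₀) (lam : ℝ), |lam| ≤ c₀ * δ ∧
      ((⟨ι (ψ i p), h⟩ : X₀), lam • (⟨ι (ψ i p), h⟩ : X₀)) ∈ (linearization ι X₀ J (Φ p)).graph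

/-- (H3) The slow eigenvectors are close to the tangent vectors in `H`. -/
def HypH3 {H : Type*} [NormedAddCommGroup H] [InnerProductSpace ℝ H] {n : ℕ}
    (P : Set (EuclideanSpace ℝ (Fin n))) (Φ : EuclideanSpace ℝ (Fin n) → H)
    (ψ : Fin n → EuclideanSpace ℝ (Fin n) → H) (C₃ δ : ℝ) : Prop :=
  ∀ p ∈ P, ∀ i, ‖ψ i p - tangentVector P Φ p i‖ ≤ C₃ * δ

/-- (H4) The slow eigenvectors are twice continuously differentiable in `p`, and they and their
second derivatives are bounded in `H`. -/
def HypH4 {H : Type*} [NormedAddCommGroup H] [InnerProductSpace ℝ H] {n : ℕ}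
    (P : Set (EuclideanSpace ℝ (Fin n)))
    (ψ : Fin n → EuclideanSpace ℝ (Fin n) → H) (C₄ : ℝ) : Prop :=
  ∀ i, ContDiffOn ℝ 2 (ψ i) P ∧
    ∀ p ∈ P, ‖ψ i p‖ + ‖iteratedFDerivWithin ℝ 2 (ψ i) P p‖ ≤ C₄

/-- (EH1) The manifold lies in the plane `u₀ + X₀` through the initial datum `u₀`. -/
def HypEH1 {H X : Type*} [NormedAddCommGroup H] [InnerProductSpace ℝ H]
    [NormedAddCommGroup X] [InnerProductSpace ℝ X] {n : ℕ}
    (ι : H →L[ℝ] X) (X₀ : Submodule ℝ X)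
    (P : Set (EuclideanSpace ℝ (Fin n))) (Φ : EuclideanSpace ℝ (Fin n) → H) (u₀ : H) : Prop :=
  ∀ p ∈ P, ι (Φ p - u₀) ∈ X₀

/-- (EA) `⟨(∇_X² J(Φ) + γ_e) v, v⟩_X ≥ μ_e ‖v‖_H²` on `H ∩ X₀`. -/
def HypEA {H X : Type*} [NormedAddCommGroup H] [InnerProductSpace ℝ H]
    [NormedAddCommGroup X] [InnerProductSpace ℝ X] {n : ℕ}
    (ι : H →L[ℝ] X) (X₀ : Submodule ℝ X) (J : H → ℝ)
    (P : Set (EuclideanSpace ℝ (Fin n))) (Φ : EuclideanSpace ℝ (Fin n) → H)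
    (μe γe : ℝ) : Prop :=
  ∀ p ∈ P, ∀ v : H, ι v ∈ X₀ →
    μe * ‖v‖ ^ 2 ≤ secondVariation J (Φ p) v v + γe * ‖ι v‖ ^ 2

end Hypotheses

-- On the `X`-orthogonal complement of the slow eigenvectors, the spectral gap bounds the second
-- variation below by `ks ‖ιz‖²`. Adding `γe` times this to `ks` times the Gårding-type inequality
-- (EA) cancels the `X`-norms and gives coercivity in `H` with constant `m = ks μe / (ks + γe)`. A
-- vector orthogonal to the tangent plane is orthogonal to each `ψ i` up to `O(δ) ‖v‖`, by (H3). Its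
-- slow component is therefore small in `H`, decouples from the rest in the form, and contributes at
-- worst a small multiple of `-‖v‖²`, so that coercivity survives with constant `m / 8`.
--
-- The main work is the first bound, in `le_secondVariation_of_orthogonal`: a gap in the spectrum
-- must become an inequality for the form on all of `H ∩ X₀`, not only on the operator domain. By
-- Lax–Milgram the shifted form has a bounded symmetric solution operator `R = (γe - 𝕃)⁻¹`, and `λ ↦
-- (γe - λ)⁻¹` turns the gap into a gap for `R`. The bounded case is elementary:
-- `le_norm_apply_of_surjective_sub_smul` replaces the spectral theorem, and
-- `inner_apply_self_le_of_mem_orthogonal` removes the slow eigenvalues.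
-- `le_apply_self_of_almost_orthogonal` is the perturbation step.

-- Spectral bounds for bounded symmetric operators.

section SymmetricOperators

variable {E : Type*} [NormedAddCommGroup E] [InnerProductSpace ℝ E]

theorem injective_of_symmetric_of_surjective {S : E →L[ℝ] E}
    (hS : ∀ x y, inner ℝ (S x) y = inner ℝ x (S y)) (h : Function.Surjective S) :
    Function.Injective S := by
  rw [injective_iff_map_eq_zero]
  intro x hx
  obtain ⟨y, rfl⟩ := h x
  rw [← inner_self_eq_zero (𝕜 := ℝ), hS, hx, inner_zero_right]

/-- If the symmetric operator `S` has no spectrum in `(-ρ, ρ)`, then `ρ ‖x‖ ≤ ‖S x‖`. -/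
theorem le_norm_apply_of_surjective_sub_smul [CompleteSpace E] {S : E →L[ℝ] E}
    (hS : ∀ x y, inner ℝ (S x) y = inner ℝ x (S y)) {ρ : ℝ} (hρ : 0 < ρ)
    (h : ∀ s : ℝ, |s| < ρ → ∀ y, ∃ x, S x - s • x = y) (x : E) : ρ * ‖x‖ ≤ ‖S x‖ := by
  have hsurj : Function.Surjective S := fun y => by
    obtain ⟨x, hx⟩ := h 0 (by simpa using hρ) y
    exact ⟨x, by simpa using hx⟩
  have hinj := injective_of_symmetric_of_surjective hS hsurj
  let e := ContinuousLinearEquiv.ofBijective S (LinearMap.ker_eq_bot.2 hinj)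
    (LinearMap.range_eq_top.2 hsurj)
  have he : ∀ x, e x = S x := fun x => rfl
  let R : E →L[ℝ] E := e.symm
  have hSR : ∀ y, S (R y) = y := fun y => e.apply_symm_apply y
  have hRS : ∀ y, R (S y) = y := fun y => e.symm_apply_apply y
  have hR : ∀ x y, inner ℝ (R x) y = inner ℝ x (R y) := fun x y => by
    conv_lhs => rw [← hSR y, ← hS, hSR]
  by_contra! hx
  have hxpos : 0 < ‖x‖ := by
    by_contra! h0
    nlinarith [norm_nonneg (S x)]
  have hr : 1 < ‖R‖ * ρ := by
    have h1 := R.le_opNorm (S x)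
    rw [hRS] at h1
    have h2 : ‖R‖ * ‖S x‖ ≤ ‖R‖ * (ρ * ‖x‖) := by gcongr
    rcases (norm_nonneg R).eq_or_lt with h0 | h0
    · rw [← h0] at h1; linarith
    · have h3 : ‖R‖ * ‖S x‖ < ‖R‖ * (ρ * ‖x‖) := by gcongr
      have : 1 * ‖x‖ < ‖R‖ * ρ * ‖x‖ := by linarith
      exact lt_of_mul_lt_mul_right this hxpos.le
  -- The contradiction comes from the fact that `r` or `-r` is an approximate eigenvalue of `R =
  -- S⁻¹`, whereas `S ∓ r⁻¹` is onto because `r⁻¹ < ρ`. Working with squares avoids deciding the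
  -- sign.
  set r := ‖R‖ with hrdef
  have hr0 : 0 < r := by
    by_contra! h0
    nlinarith
  have hs : |r⁻¹| < ρ := by
    rw [abs_of_pos (inv_pos.2 hr0), inv_lt_iff_one_lt_mul₀ hr0]
    linarith
  -- `N = (S - r⁻¹)(S + r⁻¹)` is onto as a product, hence boundedly invertible by symmetry.
  let N : E →L[ℝ] E := S.comp S - (r⁻¹ ^ 2) • ContinuousLinearMap.id ℝ E
  have hNapp : ∀ x, N x = S (S x) - (r⁻¹ ^ 2) • x := fun x => rfl
  have hNsymm : ∀ x y, inner ℝ (N x) y = inner ℝ x (N y) := fun x y => by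
    simp only [hNapp, inner_sub_left, inner_sub_right, hS, real_inner_smul_left,
      real_inner_smul_right]
  have hNsurj : Function.Surjective N := fun y => by
    obtain ⟨u, hu⟩ := h r⁻¹ hs y
    obtain ⟨v, hv⟩ := h (-r⁻¹) (by rwa [abs_neg]) u
    refine ⟨v, ?_⟩
    rw [hNapp, ← hu, ← hv]
    simp only [map_sub, map_smul]
    module
  have hNinj := injective_of_symmetric_of_surjective hNsymm hNsurj
  let eN := ContinuousLinearEquiv.ofBijective N (LinearMap.ker_eq_bot.2 hNinj)
    (LinearMap.range_eq_top.2 hNsurj)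
  let M : E →L[ℝ] E := eN.symm
  have hMN : ∀ y, M (N y) = y := fun y => eN.symm_apply_apply y
  have key : ∀ y, ‖y‖ ^ 2 ≤ (‖S‖ ^ 2 * ‖M‖ * r⁻¹ ^ 2) ^ 2 * r ^ 2
      * (r ^ 2 * ‖y‖ ^ 2 - ‖R y‖ ^ 2) := fun y => by
    have h1 : ‖y‖ ≤ ‖S‖ * (‖S‖ * ‖R (R y)‖) := by
      calc ‖y‖ = ‖S (S (R (R y)))‖ := by rw [hSR, hSR]
        _ ≤ _ := (S.le_opNorm _).trans (by gcongr; exact S.le_opNorm _)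
    have h2 : ‖R (R y)‖ ≤ ‖M‖ * ‖N (R (R y))‖ := by
      conv_lhs => rw [← hMN (R (R y))]
      exact M.le_opNorm _
    have h3 : N (R (R y)) = -(r⁻¹ ^ 2) • (R (R y) - r ^ 2 • y) := by
      rw [hNapp, hSR, hSR, smul_sub, smul_smul]
      have : -r⁻¹ ^ 2 * r ^ 2 = -1 := by field_simp
      rw [this]; module
    -- If `‖R y‖` is nearly `r ‖y‖`, then `y` is nearly an eigenvector of `R²` for `r²`. The bounded
    -- inverse of `N` forbids this uniformly, which pushes `‖R‖` strictly below `r`.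
    have h4 : ‖R (R y) - r ^ 2 • y‖ ^ 2 ≤ r ^ 2 * (r ^ 2 * ‖y‖ ^ 2 - ‖R y‖ ^ 2) := by
      rw [norm_sub_sq_real, real_inner_smul_right, hR, real_inner_self_eq_norm_sq, norm_smul,
        Real.norm_eq_abs, abs_of_pos (by positivity)]
      have : ‖R (R y)‖ ^ 2 ≤ (r * ‖R y‖) ^ 2 := by gcongr; exact R.le_opNorm _
      nlinarith
    have h5 : ‖N (R (R y))‖ = r⁻¹ ^ 2 * ‖R (R y) - r ^ 2 • y‖ := by
      rw [h3, norm_smul, norm_neg, Real.norm_eq_abs, abs_of_pos (by positivity)]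
    have h6 : ‖y‖ ≤ (‖S‖ ^ 2 * ‖M‖ * r⁻¹ ^ 2) * ‖R (R y) - r ^ 2 • y‖ := by
      calc ‖y‖ ≤ ‖S‖ * (‖S‖ * (‖M‖ * ‖N (R (R y))‖)) := h1.trans (by gcongr)
        _ = _ := by rw [h5]; ring
    calc ‖y‖ ^ 2 ≤ ((‖S‖ ^ 2 * ‖M‖ * r⁻¹ ^ 2) * ‖R (R y) - r ^ 2 • y‖) ^ 2 := by gcongr
      _ = (‖S‖ ^ 2 * ‖M‖ * r⁻¹ ^ 2) ^ 2 * ‖R (R y) - r ^ 2 • y‖ ^ 2 := by ring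
      _ ≤ (‖S‖ ^ 2 * ‖M‖ * r⁻¹ ^ 2) ^ 2 * (r ^ 2 * (r ^ 2 * ‖y‖ ^ 2 - ‖R y‖ ^ 2)) := by gcongr
      _ = _ := by ring
  set K := (‖S‖ ^ 2 * ‖M‖ * r⁻¹ ^ 2) ^ 2 * r ^ 2 with hK
  have hK0 : 0 < K := by
    by_contra! h0
    have : K = 0 := le_antisymm h0 (by positivity)
    have h1 := key x
    rw [this] at h1
    nlinarith
  have hbd : ∀ y, ‖R y‖ ^ 2 ≤ (r ^ 2 - K⁻¹) * ‖y‖ ^ 2 := fun y => by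
    have h1 := mul_le_mul_of_nonneg_left (key y) (inv_pos.2 hK0).le
    rw [← mul_assoc, inv_mul_cancel₀ hK0.ne'] at h1
    linarith
  have hpos : 0 ≤ r ^ 2 - K⁻¹ := by
    by_contra! h0
    nlinarith [hbd x, sq_nonneg ‖R x‖, pow_pos hxpos 2]
  have hle : r ≤ √(r ^ 2 - K⁻¹) := by
    refine R.opNorm_le_bound (Real.sqrt_nonneg _) fun y => ?_
    refine abs_le_of_sq_le_sq' ?_ (by positivity) |>.2
    rw [mul_pow, Real.sq_sqrt hpos]
    exact hbd y
  have := (Real.le_sqrt hr0.le hpos).1 hle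
  linarith [inv_pos.2 hK0]

/-- A punctured neighbourhood of `0` free of spectrum forces an injective symmetric operator to
be onto. -/
theorem surjective_of_injective_of_isolated [CompleteSpace E] {T : E →L[ℝ] E}
    (hT : ∀ x y, inner ℝ (T x) y = inner ℝ x (T y)) (hinj : ∀ x, T x = 0 → x = 0)
    {a : ℝ} (ha : 0 < a)
    (h : ∀ s : ℝ, s ≠ 0 → |s| < a → ∀ y, ∃ x, T x - s • x = y) : Function.Surjective T := by
  -- The spectral parameters of `T²` in `(0, a²)` factor through `±√`, avoiding `0`, where
  -- surjectivity is not yet known. Centred at `a² / 2`, this interval is a gap for `K`. Expanding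
  -- `‖K x‖ ≥ (a² / 2) ‖x‖` cancels the `‖x‖²` terms and leaves `a ‖T x‖ ≤ ‖T (T x)‖`, a lower bound
  -- on the range of `T`, which is dense.
  let K : E →L[ℝ] E := T.comp T - (a ^ 2 / 2) • ContinuousLinearMap.id ℝ E
  have hKapp : ∀ x, K x = T (T x) - (a ^ 2 / 2) • x := fun x => rfl
  have hKsymm : ∀ x y, inner ℝ (K x) y = inner ℝ x (K y) := fun x y => by
    simp only [hKapp, inner_sub_left, inner_sub_right, hT, real_inner_smul_left,
      real_inner_smul_right]
  have hK := le_norm_apply_of_surjective_sub_smul hKsymm (ρ := a ^ 2 / 2) (by positivity)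
    (fun s hs y => by
      obtain ⟨hs1, hs2⟩ := abs_lt.1 hs
      have hu : 0 < a ^ 2 / 2 + s := by linarith
      have hu1 := Real.sqrt_pos.2 hu
      have hu2 : √(a ^ 2 / 2 + s) < a := (Real.sqrt_lt' ha).2 (by linarith)
      obtain ⟨u, hu'⟩ := h _ hu1.ne' (by rwa [abs_of_pos hu1]) y
      obtain ⟨v, hv⟩ := h (-√(a ^ 2 / 2 + s)) (neg_ne_zero.2 hu1.ne')
        (by rwa [abs_neg, abs_of_pos hu1]) u
      refine ⟨v, ?_⟩
      have hsq : (a ^ 2 / 2 + s) = √(a ^ 2 / 2 + s) * √(a ^ 2 / 2 + s) :=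
        (Real.mul_self_sqrt hu.le).symm
      have : K v - s • v = T (T v) - (a ^ 2 / 2 + s) • v := by rw [hKapp]; module
      rw [this, ← hu', ← hv]
      conv_lhs => rw [hsq]
      simp only [map_sub, map_smul]
      module)
  have hrange : ∀ x, a * ‖T x‖ ≤ ‖T (T x)‖ := fun x => by
    have h1 : (a ^ 2 / 2 * ‖x‖) ^ 2 ≤ ‖K x‖ ^ 2 := by gcongr; exact hK x
    rw [hKapp, norm_sub_sq_real, real_inner_smul_right, hT, real_inner_self_eq_norm_sq,
      norm_smul, Real.norm_eq_abs, abs_of_pos (by positivity)] at h1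
    refine abs_le_of_sq_le_sq' ?_ (by positivity) |>.2
    nlinarith
  have hdense : DenseRange T := by
    have : (LinearMap.range (T : E →ₗ[ℝ] E)).topologicalClosure = ⊤ := by
      rw [Submodule.topologicalClosure_eq_top_iff, Submodule.eq_bot_iff]
      intro x hx
      apply hinj
      rw [← inner_self_eq_zero (𝕜 := ℝ)]
      have := (Submodule.mem_orthogonal _ _).1 hx (T (T x)) ⟨T x, rfl⟩
      rwa [hT] at this
    have h2 := (Submodule.dense_iff_topologicalClosure_eq_top).2 this
    exact h2
  have hall : ∀ y, a * ‖y‖ ≤ ‖T y‖ := fun y => by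
    refine hdense.induction_on (p := fun y => a * ‖y‖ ≤ ‖T y‖) y ?_ hrange
    exact isClosed_le (by fun_prop) (by fun_prop)
  have hanti : AntilipschitzWith (⟨a⁻¹, by positivity⟩ : ℝ≥0) T := by
    refine AddMonoidHomClass.antilipschitz_of_bound T fun y => ?_
    have := hall y
    show ‖y‖ ≤ a⁻¹ * ‖T y‖
    rw [inv_mul_eq_div, le_div_iff₀ ha]
    linarith
  have hcl : IsClosed (range T) := hanti.isClosed_range T.uniformContinuous
  rw [← range_eq_univ, ← hcl.closure_eq]
  exact hdense.closure_range

/-- A symmetric operator without spectrum in `(τ, ∞)` is bounded above by `τ`. -/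
theorem inner_apply_self_le_of_surjective_sub_smul [CompleteSpace E] {T : E →L[ℝ] E}
    (hT : ∀ x y, inner ℝ (T x) y = inner ℝ x (T y)) {τ : ℝ}
    (h : ∀ t : ℝ, τ < t → ∀ y, ∃ x, T x - t • x = y) (x : E) :
    inner ℝ (T x) x ≤ τ * ‖x‖ ^ 2 := by
  -- This is the gap of radius `c - τ` around `c`, squared and expanded. The `c²` terms cancel, and
  -- since the right-hand side does not depend on `c`, letting `c` grow gives the claim.
  have key : ∀ c, τ < c → 2 * c * (inner ℝ (T x) x - τ * ‖x‖ ^ 2)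
      ≤ ‖T x‖ ^ 2 - τ ^ 2 * ‖x‖ ^ 2 := fun c hc => by
    let S : E →L[ℝ] E := T - c • ContinuousLinearMap.id ℝ E
    have hSapp : ∀ x, S x = T x - c • x := fun x => rfl
    have h1 := le_norm_apply_of_surjective_sub_smul (S := S) (ρ := c - τ)
      (fun x y => by
        simp only [hSapp, inner_sub_left, inner_sub_right, hT, real_inner_smul_left,
          real_inner_smul_right]) (by linarith)
      (fun s hs y => by
        obtain ⟨z, hz⟩ := h (c + s) (by linarith [(abs_lt.1 hs).1]) y
        exact ⟨z, by rw [← hz, hSapp]; module⟩) x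
    have h2 : ((c - τ) * ‖x‖) ^ 2 ≤ ‖S x‖ ^ 2 := by
      have : 0 < c - τ := by linarith
      gcongr
    rw [hSapp, norm_sub_sq_real, real_inner_smul_right, norm_smul, Real.norm_eq_abs, mul_pow, mul_pow,
      sq_abs] at h2
    nlinarith
  by_contra! hlt
  set d := inner ℝ (T x) x - τ * ‖x‖ ^ 2 with hd
  have hd0 : 0 < d := by linarith
  set B := ‖T x‖ ^ 2 - τ ^ 2 * ‖x‖ ^ 2 with hB
  have h1 := key (|τ| + 1 + |B| / d) (by
    have := le_abs_self τ
    have : 0 ≤ |B| / d := by positivity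
    linarith)
  have h2 : |B| / d * d = |B| := by field_simp
  have h3 : 2 * (|τ| + 1 + |B| / d) * d = 2 * (|τ| + 1) * d + 2 * |B| := by
    linear_combination 2 * h2
  rw [h3] at h1
  have := le_abs_self B
  have : 0 < (|τ| + 1) * d := by positivity
  linarith [abs_nonneg B]

/-- A symmetric operator leaving a finite-dimensional `Y` invariant, whose spectrum in `(τ, ∞)`
is finite and has no eigenvectors orthogonal to `Y`, is bounded above by `τ` on `Yᗮ`. -/
theorem inner_apply_self_le_of_mem_orthogonal [CompleteSpace E] {R : E →L[ℝ] E}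
    (hR : ∀ x y, inner ℝ (R x) y = inner ℝ x (R y)) {Y : Submodule ℝ E}
    [Y.HasOrthogonalProjection]
    (hY : ∀ y ∈ Y, R y ∈ Y) {τ : ℝ} (hτ : 0 < τ) {F : Set ℝ} (hF : F.Finite)
    (h : ∀ t : ℝ, τ < t → t ∉ F → ∀ y, ∃ x, R x - t • x = y)
    (hFY : ∀ t ∈ F, τ < t → ∀ x ∈ Yᗮ, R x = t • x → x = 0) {x : E} (hx : x ∈ Yᗮ) :
    inner ℝ (R x) x ≤ τ * ‖x‖ ^ 2 := by
  have hY' : ∀ z ∈ Yᗮ, R z ∈ Yᗮ := fun z hz => by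
    rw [Submodule.mem_orthogonal] at hz ⊢
    intro u hu
    rw [← hR]
    exact hz _ (hY u hu)
  let P : E →L[ℝ] E := Yᗮ.starProjection
  have hPmem : ∀ z, P z ∈ Yᗮ := fun z => Submodule.starProjection_apply_mem _ z
  have hPfix : ∀ z ∈ Yᗮ, P z = z := fun z hz => Submodule.starProjection_eq_self_iff.2 hz
  have hPsub : ∀ z, z - P z ∈ Y := fun z => by
    have := Submodule.sub_starProjection_mem_orthogonal (K := Yᗮ) z
    rwa [Submodule.orthogonal_orthogonal] at this
  have hP0 : ∀ z ∈ Y, P z = 0 := fun z hz => by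
    have h1 : P z ∈ Y := by
      have := Y.sub_mem hz (hPsub z)
      rwa [sub_sub_cancel] at this
    exact (Submodule.mem_bot ℝ).1 (Y.inf_orthogonal_eq_bot ▸ ⟨h1, hPmem z⟩)
  have hcomm : ∀ z, P (R z) = R (P z) := fun z => by
    have h1 : P (R (z - P z)) = 0 := hP0 _ (hY _ (hPsub z))
    rw [map_sub, map_sub, hPfix (R (P z)) (hY' _ (hPmem z))] at h1
    exact sub_eq_zero.1 h1
  have hPsymm : ∀ u v, inner ℝ (P u) v = inner ℝ u (P v) := fun u v =>
    Submodule.inner_starProjection_left_eq_right _ u v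
  -- `T` agrees with `R` on `Yᗮ` and vanishes on `Y`. As `t > τ > 0`, `T - t` is invertible on `Y`,
  -- so only `Yᗮ` matters. Each `t ∈ F` is isolated, and injectivity there gives surjectivity.
  let T : E →L[ℝ] E := R.comp P
  have hTapp : ∀ z, T z = R (P z) := fun z => rfl
  have hT : ∀ u v, inner ℝ (T u) v = inner ℝ u (T v) := fun u v => by
    rw [hTapp, hTapp, hR, hPsymm, hcomm]
  have hsurj : ∀ t : ℝ, τ < t → t ∉ F → ∀ y, ∃ x, T x - t • x = y := fun t ht htF y => by
    have ht0 : t ≠ 0 := (hτ.trans ht).ne'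
    obtain ⟨u, hu⟩ := h t ht htF (P y)
    refine ⟨P u - t⁻¹ • (y - P y), ?_⟩
    have h1 : R (P u) - t • P u = P y := by
      rw [← hcomm, ← map_smul, ← map_sub, hu, hPfix _ (hPmem y)]
    rw [hTapp, map_sub, map_smul, hP0 _ (hPsub y), hPfix _ (hPmem u), smul_zero, sub_zero,
      smul_sub, smul_smul, mul_inv_cancel₀ ht0, one_smul]
    calc R (P u) - (t • P u - (y - P y)) = (R (P u) - t • P u) + (y - P y) := by abel
      _ = y := by rw [h1]; abel
  have hall : ∀ t : ℝ, τ < t → ∀ y, ∃ x, T x - t • x = y := fun t ht => by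
    by_cases htF : t ∈ F
    swap
    · exact hsurj t ht htF
    have ht0 : t ≠ 0 := (hτ.trans ht).ne'
    have hnhds : (F \ {t})ᶜ ∩ Ioi τ ∈ 𝓝 t :=
      inter_mem ((hF.subset sdiff_subset).isClosed.isOpen_compl.mem_nhds (by simp))
        (Ioi_mem_nhds ht)
    obtain ⟨a, ha, hball⟩ := Metric.mem_nhds_iff.1 hnhds
    let S : E →L[ℝ] E := T - t • ContinuousLinearMap.id ℝ E
    have hSapp : ∀ x, S x = T x - t • x := fun x => rfl
    refine surjective_of_injective_of_isolated (T := S) ?_ ?_ ha ?_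
    · intro u v
      simp only [hSapp, inner_sub_left, inner_sub_right, hT, real_inner_smul_left,
        real_inner_smul_right]
    · intro u hu
      rw [hSapp, sub_eq_zero, hTapp] at hu
      have hu' : u ∈ Yᗮ := by
        have : u = t⁻¹ • R (P u) := by rw [hu, smul_smul, inv_mul_cancel₀ ht0, one_smul]
        rw [this]
        exact Yᗮ.smul_mem _ (hY' _ (hPmem u))
      rw [hPfix u hu'] at hu
      exact hFY t htF ht u hu' hu
    · intro s hs hsa y
      have hmem : t + s ∈ Metric.ball t a := by simpa [Metric.mem_ball, Real.dist_eq] using hsa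
      obtain ⟨h1, h2⟩ := hball hmem
      have h3 : t + s ∉ F := fun h4 => h1 ⟨h4, by simpa using hs⟩
      obtain ⟨z, hz⟩ := hsurj (t + s) h2 h3 y
      exact ⟨z, by rw [← hz, hSapp]; module⟩
  have := inner_apply_self_le_of_surjective_sub_smul hT hall x
  rwa [hTapp, hPfix x hx] at this

end SymmetricOperators

-- Variational problems for coercive forms.

section Forms

variable {V E : Type*} [NormedAddCommGroup V] [InnerProductSpace ℝ V]
  [NormedAddCommGroup E] [InnerProductSpace ℝ E]

/-- The solution operator of the variational problem `a(G f, w) = ⟨f, j w⟩`. -/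
theorem IsCoercive.exists_solution_operator [CompleteSpace V] [CompleteSpace E]
    {a : V →L[ℝ] V →L[ℝ] ℝ} (ha : IsCoercive a)
    (j : V →L[ℝ] E) : ∃ G : E →L[ℝ] V, ∀ f w, a (G f) w = inner ℝ f (j w) := by
  refine ⟨(ha.continuousLinearEquivOfBilin.symm : V →L[ℝ] V).comp
    (ContinuousLinearMap.adjoint j), fun f w => ?_⟩
  rw [← ha.continuousLinearEquivOfBilin_apply]
  simp [ContinuousLinearMap.adjoint_inner_left]

theorem IsCoercive.eq_of_forall_apply_eq {a : V →L[ℝ] V →L[ℝ] ℝ} (ha : IsCoercive a) {u v : V}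
    (h : ∀ w, a u w = a v w) : u = v := by
  obtain ⟨C, hC, hb⟩ := ha
  have h1 := hb (u - v)
  have h0 : a (u - v) (u - v) = 0 := by
    rw [map_sub a]
    exact sub_eq_zero.2 (h _)
  rw [h0] at h1
  by_contra hne
  have h2 : 0 < ‖u - v‖ := norm_pos_iff.2 (sub_ne_zero.2 hne)
  have : 0 < C * ‖u - v‖ * ‖u - v‖ := by positivity
  linarith

end Forms

-- Density of `H ∩ X₀` in `X₀`.

section Density

variable {H X : Type*} [NormedAddCommGroup H] [InnerProductSpace ℝ H]
  [NormedAddCommGroup X] [InnerProductSpace ℝ X] [CompleteSpace X]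

/-- The intersection of a dense subspace with a closed subspace `X₀` of finite codimension is
dense in `X₀`: only `0 ∈ X₀` is orthogonal to it. -/
theorem eq_zero_of_forall_inner_eq_zero {ι : H →L[ℝ] X} (hι : DenseRange ι)
    {X₀ : Submodule ℝ X} (hX₀ : IsClosed (X₀ : Set X)) [FiniteDimensional ℝ X₀ᗮ] {f : X}
    (hf : f ∈ X₀) (h : ∀ w : H, ι w ∈ X₀ → inner ℝ f (ι w) = 0) : f = 0 := by
  have : CompleteSpace X₀ := hX₀.completeSpace_coe
  let A : H →ₗ[ℝ] X₀ᗮ := (X₀ᗮ.orthogonalProjectionOnto : X →ₗ[ℝ] X₀ᗮ) ∘ₗ (ι : H →ₗ[ℝ] X)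
  let φ : H →ₗ[ℝ] ℝ := (innerSL ℝ f : X →ₗ[ℝ] ℝ) ∘ₗ (ι : H →ₗ[ℝ] X)
  have hker : LinearMap.ker A ≤ LinearMap.ker φ := fun w hw => by
    have h1 : X₀ᗮ.orthogonalProjectionOnto (ι w) = 0 := hw
    rw [Submodule.orthogonalProjectionOnto_eq_zero_iff, Submodule.orthogonal_orthogonal] at h1
    exact h w h1
  -- Since `w ↦ ⟨f, ιw⟩` vanishes on `ker A`, it factors through the finite-dimensional `X₀ᗮ`. There
  -- Riesz represents it by some `g`, and density of `ι` forces `f = g ∈ X₀ ⊓ X₀ᗮ`.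
  obtain ⟨L, hL⟩ : φ ∈ LinearMap.range A.dualMap := by
    rw [LinearMap.range_dualMap_eq_dualAnnihilator_ker, Submodule.mem_dualAnnihilator]
    exact fun w hw => hker hw
  let g : X₀ᗮ := (InnerProductSpace.toDual ℝ X₀ᗮ).symm (LinearMap.toContinuousLinearMap L)
  have hg : ∀ w, inner ℝ (g : X) (ι w) = inner ℝ f (ι w) := fun w => by
    have h1 : inner ℝ g (X₀ᗮ.orthogonalProjectionOnto (ι w)) = L (A w) := by
      rw [InnerProductSpace.toDual_symm_apply]; rfl
    have h2 : L (A w) = φ w := by rw [← hL]; rfl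
    rw [Submodule.inner_orthogonalProjectionOnto_eq_of_mem_left] at h1
    rw [h1, h2]; rfl
  have hfg : f = g := hι.eq_of_inner_left ℝ fun w => (hg w).symm
  have : f ∈ X₀ ⊓ X₀ᗮ := ⟨hf, hfg ▸ g.2⟩
  rw [X₀.inf_orthogonal_eq_bot] at this
  exact (Submodule.mem_bot ℝ).1 this

end Density

-- From the spectral gap of the linearization to a lower bound for the form.

section Linearization

variable {H X : Type*} [NormedAddCommGroup H] [InnerProductSpace ℝ H]
  [NormedAddCommGroup X] [InnerProductSpace ℝ X] [CompleteSpace X]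

/-- `toLinearPMap` has the prescribed graph only if that graph is single-valued. Over `0` this means
that `f ∈ X₀` orthogonal to `H ∩ X₀` vanishes, which is the density result. -/
theorem graph_linearization {ι : H →L[ℝ] X} (hinj : Function.Injective ι) (hι : DenseRange ι)
    {X₀ : Submodule ℝ X} (hX₀ : IsClosed (X₀ : Set X)) [FiniteDimensional ℝ X₀ᗮ]
    (J : H → ℝ) (u : H) :
    (linearization ι X₀ J u).graph = linearizationGraph ι X₀ J u := by
  refine Submodule.toLinearPMap_graph_eq _ ?_
  rintro ⟨x, f⟩ ⟨v, hv, hf⟩ (rfl : x = 0)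
  have hv0 : v = 0 := hinj (by rw [hv, map_zero]; rfl)
  subst hv0
  refine Subtype.ext (eq_zero_of_forall_inner_eq_zero hι hX₀ f.2 fun w hw => ?_)
  rw [hf w hw]
  simp [secondVariation]

/-- If the form is coercive up to a shift, then a spectral gap of the linearization makes the
form bounded below by `ks` on the `X`-orthogonal complement of the slow eigenvectors. -/
theorem le_secondVariation_of_orthogonal [CompleteSpace H] {n : ℕ}
    {ι : H →L[ℝ] X} (hinj : Function.Injective ι) (hι : DenseRange ι)
    {X₀ : Submodule ℝ X} (hX₀ : IsClosed (X₀ : Set X)) [FiniteDimensional ℝ X₀ᗮ]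
    {J : H → ℝ} {u : H} {ks r μe γe : ℝ} (hks : 0 < ks) (hμe : 0 < μe)
    (hγe : 0 < γe)
    (hsymm : ∀ v w, secondVariation J u v w = secondVariation J u w v)
    (hEA : ∀ v : H, ι v ∈ X₀ → μe * ‖v‖ ^ 2 ≤ secondVariation J u v v + γe * ‖ι v‖ ^ 2)
    (hspec : ∀ lam ∈ pmapSpectrum (linearization ι X₀ J u), lam ≤ -ks ∨ |lam| ≤ r)
    (heig : ∀ lam ∈ pmapSpectrum (linearization ι X₀ J u), |lam| ≤ r →
      ∃ x : X₀, x ≠ 0 ∧ (x, lam • x) ∈ (linearization ι X₀ J u).graph)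
    [FiniteDimensional ℝ (slowEigenspace (linearization ι X₀ J u) r)]
    (hrank : Module.finrank ℝ (slowEigenspace (linearization ι X₀ J u) r) = n)
    {ψ : Fin n → H} (hψX : ∀ i, ι (ψ i) ∈ X₀) (hψo : Orthonormal ℝ (fun i => ι (ψ i)))
    {l : Fin n → ℝ} (hl : ∀ i, |l i| ≤ r)
    (hψ : ∀ i, ((⟨ι (ψ i), hψX i⟩ : X₀), l i • (⟨ι (ψ i), hψX i⟩ : X₀)) ∈
      (linearization ι X₀ J u).graph)
    {v : H} (hv : ι v ∈ X₀) (hvψ : ∀ i, inner ℝ (ι (ψ i)) (ι v) = 0) :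
    ks * ‖ι v‖ ^ 2 ≤ secondVariation J u v v := by
  have : CompleteSpace X₀ := hX₀.completeSpace_coe
  set A := linearization ι X₀ J u
  have hgraph : A.graph = linearizationGraph ι X₀ J u := graph_linearization hinj hι hX₀ J u
  let V : Submodule ℝ H := X₀.comap (ι : H →ₗ[ℝ] X)
  have hVcl : IsClosed (V : Set H) := hX₀.preimage ι.continuous
  have : CompleteSpace V := hVcl.completeSpace_coe
  let j : V →L[ℝ] X₀ := (ι.comp V.subtypeL).codRestrict X₀ (fun v => v.2)
  have hj : ∀ v : V, ((j v : X₀) : X) = ι v := fun v => rfl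
  let ip : X₀ →L[ℝ] X₀ →L[ℝ] ℝ := innerSL ℝ
  let a : V →L[ℝ] V →L[ℝ] ℝ :=
    ((fderiv ℝ (fderiv ℝ J) u).bilinearComp V.subtypeL V.subtypeL)
      + γe • ip.bilinearComp j j
  have ha : ∀ v w : V, a v w = secondVariation J u v w + γe * inner ℝ (j v) (j w) :=
    fun v w => rfl
  have hasymm : ∀ v w, a v w = a w v := fun v w => by
    rw [ha, ha, hsymm, real_inner_comm]
  have hpos : ∀ v : V, μe * ‖v‖ ^ 2 ≤ a v v := fun v => by
    rw [ha, real_inner_self_eq_norm_sq]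
    exact hEA v v.2
  have hcoer : IsCoercive a := ⟨μe, hμe, fun v => by
    have := hpos v
    rw [mul_assoc, ← sq]; exact this⟩
  obtain ⟨G, hG⟩ := hcoer.exists_solution_operator j
  have hGuniq : ∀ (v : V) (f : X₀), (∀ w, a v w = inner ℝ f (j w)) → v = G f :=
    fun v f h => hcoer.eq_of_forall_apply_eq fun w => by rw [h, hG]
  let R : X₀ →L[ℝ] X₀ := j.comp G
  have hRapp : ∀ f, R f = j (G f) := fun f => rfl
  have hR : ∀ f g, inner ℝ (R f) g = inner ℝ f (R g) := fun f g => by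
    rw [real_inner_comm, hRapp, ← hG, hasymm, hG, hRapp]
  -- membership in the graph of `A`, in terms of the resolvent `R = (γe - A)⁻¹`
  have hmem : ∀ x f : X₀, (x, f) ∈ A.graph ↔ x = R (γe • x - f) := fun x f => by
    rw [hgraph]
    constructor
    · rintro ⟨v, hvx, hvf⟩
      have hvV : v ∈ V := by
        show ι v ∈ X₀
        rw [hvx]; exact x.2
      have hjv : j ⟨v, hvV⟩ = x := Subtype.ext hvx
      have h1 : (⟨v, hvV⟩ : V) = G (γe • x - f) := hGuniq _ _ fun w => by
        have h2 : inner ℝ f (j w) = -(secondVariation J u v w) := hvf w w.2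
        rw [ha, hjv, inner_sub_left, real_inner_smul_left, h2]
        ring
      rw [hRapp, ← h1, hjv]
    · intro hx
      refine ⟨G (γe • x - f), ?_, fun w hw => ?_⟩
      · rw [← hj, ← hRapp, ← hx]
      · have h1 := hG (γe • x - f) ⟨w, hw⟩
        rw [ha, ← hRapp, ← hx, inner_sub_left, real_inner_smul_left] at h1
        have h2 : inner ℝ f (j ⟨w, hw⟩) = inner ℝ (f : X) (ι w) := rfl
        rw [← h2]
        linarith
  let e : Fin n → X₀ := fun i => ⟨ι (ψ i), hψX i⟩
  have heo : Orthonormal ℝ e := by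
    refine ⟨fun i => hψo.1 i, fun i k hik => hψo.2 hik⟩
  let Y : Submodule ℝ X₀ := Submodule.span ℝ (range e)
  have : FiniteDimensional ℝ Y := FiniteDimensional.span_of_finite ℝ (finite_range e)
  -- The `n` orthonormal eigenvectors exhaust the slow eigenspace by a dimension count.
  have hYslow : Y = slowEigenspace A r := by
    refine Submodule.eq_of_le_of_finrank_eq ?_ ?_
    · refine Submodule.span_le.2 ?_
      rintro _ ⟨i, rfl⟩
      exact Submodule.subset_span ⟨l i, hl i, hψ i⟩
    · rw [hrank, finrank_span_eq_card heo.linearIndependent, Fintype.card_fin]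
  have hmemY : ∀ (x : X₀) (lam : ℝ), |lam| ≤ r → (x, lam • x) ∈ A.graph → x ∈ Y :=
    fun x lam h1 h2 => by
      rw [hYslow]
      exact Submodule.subset_span ⟨lam, h1, h2⟩
  have heig' : ∀ (x : X₀) (lam : ℝ), (x, lam • x) ∈ A.graph → x = (γe - lam) • R x :=
    fun x lam h => by
      have := (hmem _ _).1 h
      rwa [← sub_smul, map_smul] at this
  have hlt : ∀ (x : X₀) (lam : ℝ), x ≠ 0 → (x, lam • x) ∈ A.graph → lam < γe :=
    fun x lam hx h => by
      have h1 := heig' x lam h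
      have h2 : inner ℝ (R x) x = a (G x) (G x) := by rw [hG, hRapp, real_inner_comm]
      have h3 : 0 ≤ inner ℝ (R x) x := by
        rw [h2]
        exact le_trans (by positivity) (hpos (G x))
      have h4 : 0 < inner ℝ x x := real_inner_self_pos.2 hx
      have h5 : inner ℝ x x = (γe - lam) * inner ℝ (R x) x := by
        conv_lhs => rw [h1, real_inner_smul_left, ← h1]
      by_contra! h6
      nlinarith
  -- The images of the slow eigenvalues under `λ ↦ (γe - λ)⁻¹`. The threshold `(γe + ks)⁻¹` is the
  -- image of `-ks`.
  let F : Set ℝ := range fun i => (γe - l i)⁻¹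
  have hτ : 0 < (γe + ks)⁻¹ := by positivity
  have hbound : inner ℝ (R ⟨ι v, hv⟩) (⟨ι v, hv⟩ : X₀)
      ≤ (γe + ks)⁻¹ * ‖(⟨ι v, hv⟩ : X₀)‖ ^ 2 := by
    refine inner_apply_self_le_of_mem_orthogonal hR (Y := Y) (F := F) ?_ hτ
      (finite_range _) ?_ ?_ ?_
    · intro y hy
      refine Submodule.span_induction (p := fun y _ => R y ∈ Y) ?_ ?_ ?_ ?_ hy
      · rintro _ ⟨i, rfl⟩
        have h1 := heig' (e i) (l i) (hψ i)
        have h2 := hlt (e i) (l i) (heo.ne_zero i) (hψ i)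
        have h3 : R (e i) = (γe - l i)⁻¹ • e i := by
          rw [eq_inv_smul_iff₀ (by linarith), ← h1]
        rw [h3]
        exact Y.smul_mem _ (Submodule.subset_span ⟨i, rfl⟩)
      · rw [map_zero]; exact Y.zero_mem
      · intro y z _ _ h1 h2
        rw [map_add]; exact Y.add_mem h1 h2
      · intro c y _ h1
        rw [map_smul]; exact Y.smul_mem _ h1
    · intro t ht htF g
      have ht0 : 0 < t := hτ.trans ht
      have hinv : t⁻¹ < γe + ks := inv_lt_of_inv_lt₀ (by positivity) ht
      by_cases hsp : γe - t⁻¹ ∈ pmapSpectrum A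
      · exfalso
        rcases hspec _ hsp with h1 | h1
        · linarith
        · obtain ⟨x, hx0, hx⟩ := heig _ hsp h1
          have hxY : x ∈ Y := hmemY x _ h1 hx
          -- A nonzero `x ∈ Y` is not orthogonal to every `e i`. Eigenvectors of the symmetric `R`
          -- for distinct eigenvalues are orthogonal, so the eigenvalue of `x` equals some `l i` and
          -- `t ∈ F`.
          obtain ⟨i, hi⟩ : ∃ i, inner ℝ (e i) x ≠ 0 := by
            by_contra! hall
            refine hx0 ?_
            have h2 : x ∈ Yᗮ := by
              rw [Submodule.mem_orthogonal]
              intro y hy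
              refine Submodule.span_induction (p := fun y _ => inner ℝ y x = 0) ?_ ?_ ?_ ?_ hy
              · rintro _ ⟨i, rfl⟩; exact hall i
              · exact inner_zero_left _
              · intro y z _ _ h3 h4; rw [inner_add_left, h3, h4, add_zero]
              · intro c y _ h3; rw [real_inner_smul_left, h3, mul_zero]
            exact (Submodule.mem_bot ℝ).1 (Y.inf_orthogonal_eq_bot ▸ ⟨hxY, h2⟩)
          have h2 := heig' x _ hx
          have h3 := heig' (e i) (l i) (hψ i)
          have h4 := hlt (e i) (l i) (heo.ne_zero i) (hψ i)
          rw [sub_sub_cancel] at h2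
          have h5 : inner ℝ (e i) x = t⁻¹ * inner ℝ (e i) (R x) := by
            conv_lhs => rw [h2, real_inner_smul_right]
          have h6 : inner ℝ (e i) x = (γe - l i) * inner ℝ (e i) (R x) := by
            conv_lhs => rw [h3, real_inner_smul_left, hR]
          have h7 : inner ℝ (e i) (R x) ≠ 0 := fun h0 => hi (by rw [h5, h0, mul_zero])
          have h8 : t⁻¹ = γe - l i := mul_right_cancel₀ h7 (h5.symm.trans h6)
          exact htF ⟨i, by simp only; rw [← h8, inv_inv]⟩
      · have hres : γe - t⁻¹ ∈ pmapResolventSet A := not_not.1 hsp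
        obtain ⟨x, hx⟩ := hres.1 (t⁻¹ • g)
        have h1 := (hmem (x : X₀) (A x)).1 (A.mem_graph x)
        refine ⟨γe • (x : X₀) - A x, ?_⟩
        rw [← h1]
        have h2 : A x = t⁻¹ • g + (γe - t⁻¹) • (x : X₀) := by rw [← hx]; abel
        have h3 : t * t⁻¹ = 1 := mul_inv_cancel₀ ht0.ne'
        rw [h2]
        calc (x : X₀) - t • (γe • (x : X₀) - (t⁻¹ • g + (γe - t⁻¹) • (x : X₀)))
            = (1 - t * t⁻¹) • (x : X₀) + (t * t⁻¹) • g := by module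
          _ = g := by rw [h3]; simp
    · rintro _ ⟨i, rfl⟩ ht x hx hRx
      have h4 := hlt (e i) (l i) (heo.ne_zero i) (hψ i)
      have h5 : (x, l i • x) ∈ A.graph := by
        rw [hmem, ← sub_smul, map_smul, hRx, smul_smul, mul_inv_cancel₀ (by linarith), one_smul]
      have hxY := hmemY x _ (hl i) h5
      exact (Submodule.mem_bot ℝ).1 (Y.inf_orthogonal_eq_bot ▸ ⟨hxY, hx⟩)
    · rw [Submodule.mem_orthogonal]
      intro y hy
      refine Submodule.span_induction
        (p := fun y _ => inner ℝ y (⟨ι v, hv⟩ : X₀) = 0) ?_ ?_ ?_ ?_ hy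
      · rintro _ ⟨i, rfl⟩; exact hvψ i
      · exact inner_zero_left _
      · intro y z _ _ h3 h4; rw [inner_add_left, h3, h4, add_zero]
      · intro c y _ h3; rw [real_inner_smul_left, h3, mul_zero]
  let w : V := ⟨v, hv⟩
  have hjw : j w = ⟨ι v, hv⟩ := rfl
  rw [← hjw] at hbound
  -- Nonnegativity of `a` at `w - s G (j w)` with `s = γe + ks` converts the upper bound for `R`
  -- into `a w w ≥ s ‖j w‖²`. This needs only `w ∈ H ∩ X₀`, not membership in the operator domain.
  have h0 := hpos (w - (γe + ks) • G (j w))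
  have h1 : a (G (j w)) (G (j w)) = inner ℝ (R (j w)) (j w) := by
    rw [hG, hRapp, real_inner_comm]
  have h2 : a (G (j w)) w = ‖j w‖ ^ 2 := by rw [hG, real_inner_self_eq_norm_sq]
  have h3 : a w (G (j w)) = ‖j w‖ ^ 2 := by rw [hasymm, h2]
  have h4 : 0 ≤ a w w - 2 * (γe + ks) * ‖j w‖ ^ 2
      + (γe + ks) ^ 2 * inner ℝ (R (j w)) (j w) := by
    refine le_trans (le_trans (by positivity) h0) (le_of_eq ?_)
    simp only [map_sub, map_smul, sub_apply, smul_apply,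
      smul_eq_mul, h1, h2, h3]
    ring
  have h5 : (γe + ks) ^ 2 * inner ℝ (R (j w)) (j w) ≤ (γe + ks) * ‖j w‖ ^ 2 := by
    calc _ ≤ (γe + ks) ^ 2 * ((γe + ks)⁻¹ * ‖j w‖ ^ 2) := by gcongr
      _ = _ := by field_simp
  have h6 : a w w = secondVariation J u v v + γe * ‖j w‖ ^ 2 := by
    rw [ha, real_inner_self_eq_norm_sq]
  have h7 : ‖j w‖ = ‖ι v‖ := rfl
  rw [h6, h7] at h4
  rw [h7] at h5
  linarith

end Linearization

-- Stability of coercivity under almost-orthogonality.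

section Perturbation

variable {H X : Type*} [NormedAddCommGroup H] [InnerProductSpace ℝ H]
  [NormedAddCommGroup X] [InnerProductSpace ℝ X]

/-- Coercivity on the orthogonal complement of finitely many eigenvectors with small eigenvalues
persists for vectors that are almost orthogonal to these eigenvectors. -/
theorem le_apply_self_of_almost_orthogonal {n : ℕ} {ι : H →L[ℝ] X} {X₀ : Submodule ℝ X}
    {b : H →L[ℝ] H →L[ℝ] ℝ} (hsymm : ∀ v w, b v w = b w v)
    {ψ : Fin n → H} (hψX : ∀ i, ι (ψ i) ∈ X₀) (hψo : Orthonormal ℝ (fun i => ι (ψ i)))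
    {l : Fin n → ℝ} {r C ε m : ℝ} (hl : ∀ i, |l i| ≤ r)
    (heig : ∀ i w, ι w ∈ X₀ → b (ψ i) w = -(l i * inner ℝ (ι (ψ i)) (ι w)))
    (hC : ∀ i, ‖ψ i‖ ≤ C) (hm : 0 < m)
    (hfast : ∀ z, ι z ∈ X₀ → (∀ i, inner ℝ (ι (ψ i)) (ι z) = 0) → m * ‖z‖ ^ 2 ≤ b z z)
    (h1 : n * (ε * C) ≤ 1 / 2) (h2 : n * (r * ε ^ 2) ≤ m / 8)
    {v : H} (hv : ι v ∈ X₀) (hvψ : ∀ i, |inner ℝ (ι (ψ i)) (ι v)| ≤ ε * ‖v‖) :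
    m / 8 * ‖v‖ ^ 2 ≤ b v v := by
  set c : Fin n → ℝ := fun i => inner ℝ (ι (ψ i)) (ι v) with hc
  set y : H := ∑ i, c i • ψ i with hy
  have hιy : ι y = ∑ i, c i • ι (ψ i) := by simp [hy]
  have hyX : ι y ∈ X₀ := by
    rw [hιy]
    exact X₀.sum_mem fun i _ => X₀.smul_mem _ (hψX i)
  have hψy : ∀ i, inner ℝ (ι (ψ i)) (ι y) = c i := fun i => by
    rw [hιy]
    exact hψo.inner_right_fintype c i
  have hzX : ι (v - y) ∈ X₀ := by
    rw [map_sub]; exact X₀.sub_mem hv hyX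
  have hψz : ∀ i, inner ℝ (ι (ψ i)) (ι (v - y)) = 0 := fun i => by
    rw [map_sub, inner_sub_right, hψy, sub_self]
  have hby : ∀ w, ι w ∈ X₀ → b y w = ∑ i, c i * -(l i * inner ℝ (ι (ψ i)) (ι w)) :=
    fun w hw => by
      rw [hy, map_sum, sum_apply]
      refine Finset.sum_congr rfl fun i _ => ?_
      rw [map_smul, smul_apply, heig i w hw, smul_eq_mul]
  -- The slow part `y` and the remainder `v - y` are orthogonal for the form as well as in `X`. Then
  -- `‖v - y‖ ≥ ‖v‖ / 2` gives a gain of `m / 4`, of which the slow part loses at most `m / 8`.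
  have hyz : b y (v - y) = 0 := by
    rw [hby _ hzX]
    exact Finset.sum_eq_zero fun i _ => by rw [hψz]; ring
  have hbv : b v v = b y y + b (v - y) (v - y) := by
    have e1 : b (v - y) y = 0 := by rw [hsymm, hyz]
    have e2 : b v v = b (y + (v - y)) (y + (v - y)) := by rw [add_sub_cancel]
    rw [e2, map_add b, add_apply, map_add, map_add, hyz, e1]
    ring
  have hε : 0 ≤ n * (ε * ‖v‖) := by
    rw [← nsmul_eq_mul]
    rcases n with _ | n
    · simp
    · exact nsmul_nonneg ((abs_nonneg _).trans (hvψ 0)) _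
  have hyy : -(m / 8 * ‖v‖ ^ 2) ≤ b y y := by
    rw [hby _ hyX]
    have hterm : ∀ i, -(r * ε ^ 2 * ‖v‖ ^ 2) ≤ c i * -(l i * inner ℝ (ι (ψ i)) (ι y)) :=
      fun i => by
        rw [hψy]
        have e1 : l i ≤ r := (le_abs_self _).trans (hl i)
        have e0 : 0 ≤ r := (abs_nonneg _).trans (hl i)
        have e2 : c i ^ 2 ≤ (ε * ‖v‖) ^ 2 := by
          rw [← sq_abs]
          exact pow_le_pow_left₀ (abs_nonneg _) (hvψ i) 2
        have e3 : l i * c i ^ 2 ≤ r * (ε * ‖v‖) ^ 2 :=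
          (mul_le_mul_of_nonneg_right e1 (sq_nonneg _)).trans
            (mul_le_mul_of_nonneg_left e2 e0)
        linarith
    have hsum := Finset.sum_le_sum fun i (_ : i ∈ Finset.univ) => hterm i
    rw [Finset.sum_const, Finset.card_univ, Fintype.card_fin, nsmul_eq_mul] at hsum
    have := mul_le_mul_of_nonneg_right h2 (sq_nonneg ‖v‖)
    linarith
  have hynorm : ‖y‖ ≤ 1 / 2 * ‖v‖ := by
    have hterm : ∀ i, ‖c i • ψ i‖ ≤ ε * ‖v‖ * C := fun i => by
      rw [norm_smul, Real.norm_eq_abs]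
      exact mul_le_mul (hvψ i) (hC i) (norm_nonneg _) ((abs_nonneg _).trans (hvψ i))
    have hsum := norm_sum_le_of_le Finset.univ fun i _ => hterm i
    rw [Finset.sum_const, Finset.card_univ, Fintype.card_fin, nsmul_eq_mul] at hsum
    have := mul_le_mul_of_nonneg_right h1 (norm_nonneg v)
    linarith
  have hznorm : 1 / 2 * ‖v‖ ≤ ‖v - y‖ := by
    have := norm_sub_norm_le v y
    linarith
  have hzz := hfast _ hzX hψz
  have hsq : (1 / 2 * ‖v‖) ^ 2 ≤ ‖v - y‖ ^ 2 := by gcongr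
  have := mul_le_mul_of_nonneg_left hsq hm.le
  rw [hbv]
  linarith

end Perturbation

-- Uniform normal coercivity.

theorem lemmal (n : ℕ) (κ ks c₀ C₀ C₂ C₃ C₄ μe γe : ℝ)
    (hκ : 0 < κ) (hks : 0 < ks) (hc₀ : 0 < c₀) (hC₀ : 0 < C₀) (hC₂ : 0 < C₂) (hC₃ : 0 < C₃)
    (hC₄ : 0 < C₄) (hμe : 0 < μe) (hγe : 0 < γe) :
    ∃ δ₀ > (0 : ℝ), ∃ μ > (0 : ℝ),
      ∀ (H : Type*) [NormedAddCommGroup H] [InnerProductSpace ℝ H] [CompleteSpace H]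
        (X : Type*) [NormedAddCommGroup X] [InnerProductSpace ℝ X] [CompleteSpace X]
        (ι : H →L[ℝ] X) (X₀ : Submodule ℝ X) (J : H → ℝ)
        (P : Set (EuclideanSpace ℝ (Fin n))) (Φ : EuclideanSpace ℝ (Fin n) → H)
        (ψ : Fin n → EuclideanSpace ℝ (Fin n) → H) (u₀ : H) (δ : ℝ),
        Function.Injective ι → DenseRange ι → (∀ v, ‖ι v‖ ≤ κ * ‖v‖) →
        IsClosed (X₀ : Set X) → FiniteDimensional ℝ X₀ᗮ →
        UniqueDiffOn ℝ P → ContDiffOn ℝ 1 Φ P →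
        (∀ p ∈ P, ContDiffAt ℝ 2 J (Φ p)) →
        0 < δ → δ ≤ δ₀ →
        HypH0 ι X₀ J P Φ C₀ δ →
        HypH1 ι X₀ J P Φ ks c₀ δ →
        HypH2 ι X₀ J P Φ ks c₀ C₂ δ →
        IsSlowEigenbasis ι X₀ J P Φ ψ c₀ δ →
        HypH3 P Φ ψ C₃ δ →
        HypH4 P ψ C₄ →
        HypEH1 ι X₀ P Φ u₀ →
        HypEA ι X₀ J P Φ μe γe →
        ∀ p ∈ P,
          (∀ v : H, ι v ∈ X₀ → (∀ τ ∈ tangentPlane P Φ p, inner ℝ (ι τ) (ι v) = 0) →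
            μ * ‖v‖ ^ 2 ≤ secondVariation J (Φ p) v v) ∧
          (∀ (v : H) (x : (linearization ι X₀ J (Φ p)).domain), ι v = ((x : X₀) : X) →
            (∀ τ ∈ tangentPlane P Φ p, inner ℝ (ι τ) (ι v) = 0) →
            μ * ‖v‖ ^ 2 ≤ inner ℝ (-(linearization ι X₀ J (Φ p) x)) (x : X₀)) := by
  set m : ℝ := ks * μe / (ks + γe) with hm
  have hmpos : 0 < m := by positivity
  -- With `ε = κ² C₃ δ`, the two quotients ensure `n ε C₄ ≤ 1 / 2` and `n c₀ δ ε² ≤ m / 8`; the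
  -- bound `δ ≤ 1` reduces `δ³` to `δ` in the latter. Using `n + 1` keeps the denominators nonzero
  -- when `n = 0`.
  refine ⟨min 1 (min (1 / (2 * ((n + 1) * (κ ^ 2 * C₃ * C₄))))
    (m / (8 * ((n + 1) * (c₀ * (κ ^ 2 * C₃) ^ 2))))), by positivity, m / 8, by positivity, ?_⟩
  intro H _ _ _ X _ _ _ ι X₀ J P Φ ψ u₀ δ hinj hdense hκι hX₀ hfin _ _ hJ hδ hδ₀ _ hH1 _ hψ hH3
    hH4 _ hEA p hp
  obtain ⟨hδ1, hδ₀⟩ := le_min_iff.1 hδ₀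
  obtain ⟨hδ3, hδ4⟩ := le_min_iff.1 hδ₀
  rw [le_div_iff₀ (by positivity)] at hδ3 hδ4
  have hsymm : ∀ v w, secondVariation J (Φ p) v w = secondVariation J (Φ p) w v := fun v w =>
    (hJ p hp).isSymmSndFDerivAt (by simp) v w
  obtain ⟨hspec, heig, hfd, hrank, -⟩ := hH1 p hp
  obtain ⟨hψo, hψe⟩ := hψ p hp
  choose hψX l hl hψg using hψe
  have hgraph := graph_linearization hinj hdense hX₀ J (Φ p)
  have heigen : ∀ i w, ι w ∈ X₀ →
      secondVariation J (Φ p) (ψ i p) w = -(l i * inner ℝ (ι (ψ i p)) (ι w)) := fun i w hw => by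
    have h1 := hψg i
    rw [hgraph] at h1
    obtain ⟨v, hv, hv'⟩ := h1
    have hvψ : v = ψ i p := hinj hv
    subst hvψ
    have h2 := hv' w hw
    rw [Submodule.coe_smul, real_inner_smul_left] at h2
    linarith
  have hfast : ∀ z, ι z ∈ X₀ → (∀ i, inner ℝ (ι (ψ i p)) (ι z) = 0) →
      m * ‖z‖ ^ 2 ≤ secondVariation J (Φ p) z z := fun z hz hzψ => by
    have h1 := le_secondVariation_of_orthogonal hinj hdense hX₀ (r := c₀ * δ) hks
      hμe hγe hsymm (hEA p hp) hspec heig hrank hψX hψo hl hψg hz hzψ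
    have h2 := hEA p hp z hz
    have h3 := mul_le_mul_of_nonneg_left h2 hks.le
    have h4 := mul_le_mul_of_nonneg_left h1 hγe.le
    rw [hm, div_mul_eq_mul_div, div_le_iff₀ (by positivity)]
    linarith
  have main : ∀ v : H, ι v ∈ X₀ → (∀ τ ∈ tangentPlane P Φ p, inner ℝ (ι τ) (ι v) = 0) →
      m / 8 * ‖v‖ ^ 2 ≤ secondVariation J (Φ p) v v := fun v hv hvτ => by
    refine le_apply_self_of_almost_orthogonal (b := fderiv ℝ (fderiv ℝ J) (Φ p)) hsymm hψX hψo
      (r := c₀ * δ) (C := C₄) (ε := κ ^ 2 * C₃ * δ) hl heigen ?_ hmpos hfast ?_ ?_ hv ?_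
    · intro i
      have := (hH4 i).2 p hp
      have := norm_nonneg (iteratedFDerivWithin ℝ 2 (ψ i) P p)
      linarith
    · have : 0 ≤ κ ^ 2 * C₃ * δ * C₄ := by positivity
      linarith
    · have h1 : 0 ≤ c₀ * δ * (κ ^ 2 * C₃) ^ 2 := by positivity
      have h2 : δ * δ ≤ 1 := by nlinarith
      have h3 : 0 ≤ n * (c₀ * δ * (κ ^ 2 * C₃) ^ 2) := by positivity
      have h4 := mul_le_mul_of_nonneg_left h2 h3
      have h5 : n * (c₀ * δ * (κ ^ 2 * C₃ * δ) ^ 2)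
        = n * (c₀ * δ * (κ ^ 2 * C₃) ^ 2) * (δ * δ) := by ring
      rw [h5]
      linarith
    · intro i
      -- Subtracting the tangent vector costs nothing, as `v` is orthogonal to it. The remaining
      -- difference is small by (H3), and passing from `X` to `H` in both factors produces `κ²`.
      have h1 : inner ℝ (ι (ψ i p)) (ι v)
          = inner ℝ (ι (ψ i p - tangentVector P Φ p i)) (ι v) := by
        rw [map_sub, inner_sub_left, hvτ _ (Submodule.subset_span ⟨i, rfl⟩), sub_zero]
      rw [h1]
      calc _ ≤ ‖ι (ψ i p - tangentVector P Φ p i)‖ * ‖ι v‖ := abs_real_inner_le_norm _ _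
        _ ≤ (κ * (C₃ * δ)) * (κ * ‖v‖) := by
          gcongr
          · exact (hκι _).trans (by gcongr; exact hH3 p hp i)
          · exact hκι v
        _ = _ := by ring
  -- On the operator domain, injectivity of `ι` identifies `v` with the representative in the graph,
  -- so the pairing with `-𝕃` is the value of the form.
  refine ⟨main, fun v x hvx hvτ => ?_⟩
  have hv : ι v ∈ X₀ := hvx ▸ (x : X₀).2
  have h1 := (linearization ι X₀ J (Φ p)).mem_graph x
  rw [hgraph] at h1
  obtain ⟨w, hw, hw'⟩ := h1
  have hwv : w = v := hinj (hw.trans hvx.symm)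
  subst hwv
  have h2 := hw' w hv
  have h3 : inner ℝ (-(linearization ι X₀ J (Φ p) x)) (x : X₀)
      = secondVariation J (Φ p) w w := by
    rw [inner_neg_left, Submodule.coe_inner, ← hvx, h2, neg_neg]
  rw [h3]
  exact main w hv hvτ
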